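/- Let $R$ be a commutative ring with identity. An $R$-module $M$ is called quasi-projective if for every submodule $N$ of $M$ the natural map $\operatorname{Hom}_R(M,M)\to\operatorname{Hom}_R(M,M/N)$ is surjective, and $R$ is called an fqp-ring if every finitely generated ideal of $R$ is quasi-projective as an $R$-module. The weak dimension of an $R$-module $M$ is the least integer $n\ge 0$ for which there is an exact sequence $0\to E_n\to\cdots\to E_1\to E_0\to M\to 0$ with all $E_i$ flat, and $\infty$ if there is no such $n$. The weak global dimension of $R$, $\operatorname{w.gl.dim}(R)$, is the supremum of the weak dimensions of all $R$-modules. Theorem. If $R$ is an fqp-ring, then $\operatorname{w.gl.dim}(R)\in\{0,1,\infty\}$. -/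

import Mathlib

universe u

/-- `M'` is `M`-projective: for every submodule `N` of `M`, composition with the quotient map
induces a surjection `Hom(M', M) → Hom(M', M/N)`. -/
def IsRelProjective (R : Type*) [CommRing R] (M' M : Type*) [AddCommGroup M'] [Module R M']
    [AddCommGroup M] [Module R M] : Prop :=
  ∀ N : Submodule R M,
    Function.Surjective (fun f : M' →ₗ[R] M => (N.mkQ.comp f : M' →ₗ[R] M ⧸ N))

/-- A module is quasi-projective if it is projective relative to itself. -/
def IsQuasiProjective (R : Type*) [CommRing R] (M : Type*) [AddCommGroup M] [Module R M] : Prop :=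
  IsRelProjective R M M

/-- A commutative ring is an fqp-ring if every finitely generated ideal is quasi-projective
as a module over the ring. -/
def IsFqpRing (R : Type*) [CommRing R] : Prop :=
  ∀ I : Ideal R, I.FG → IsQuasiProjective R I

/-- `M` has a flat resolution `0 → E n → ⋯ → E 1 → E 0 → M → 0`. The sequence is indexed by all
natural numbers, with zero modules in the degrees above `n`. -/
def HasFlatResolutionOfLength (R : Type u) [CommRing R] (M : Type u) [AddCommGroup M] [Module R M]
    (n : ℕ) : Prop :=
  ∃ (E : ℕ → ModuleCat.{u} R) (d : ∀ i, E (i + 1) →ₗ[R] E i) (ε : E 0 →ₗ[R] M),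
    (∀ i, Module.Flat R (E i)) ∧
    (∀ i, n < i → Subsingleton (E i)) ∧
    Function.Surjective ε ∧
    Function.Exact (d 0) ε ∧
    ∀ i, Function.Exact (d (i + 1)) (d i)

/-- The weak dimension of `M`: the least length of a flat resolution of `M`, and `⊤` if there is
no flat resolution of finite length. -/
noncomputable def weakDim (R : Type u) [CommRing R] (M : Type u) [AddCommGroup M] [Module R M] :
    ℕ∞ :=
  ⨅ (n : ℕ) (_ : HasFlatResolutionOfLength R M n), (n : ℕ∞)

/-- The weak global dimension of `R`: the supremum of the weak dimensions of all `R`-modules. -/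
noncomputable def weakGlobalDim (R : Type u) [CommRing R] : ℕ∞ :=
  ⨆ M : ModuleCat.{u} R, weakDim R M

/-! If the weak global dimension is finite, every module has a finite flat resolution, and this
passes to localizations. It then suffices to show that each localization at a maximal ideal is a
valuation domain: there flat means torsion-free, so submodules of flat modules are flat and the
dimension is at most 1.

Quasi-projectivity makes each ideal `(a, b)` projective modulo its annihilator, so over a local ring
two elements are comparable under divisibility or independent modulo a common annihilator. An
incomparable pair has prime annihilator; localizing there gives a local ring with nonzero maximal
ideal of square zero, whose residue field has no finite flat resolution. Hence divisibility is total
(`AllHaveFiniteFlatDim.dvd_total`).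

In the total quotient ring of such a local ring every nonunit is a zero-divisor. Finite flat
dimension makes annihilators of nonzero elements flat, hence idempotent, and this forces the
quotient ring to be a field (`IsTotalChainRing.isUnit_of_ne_zero`). -/

open TensorProduct IsLocalRing

/-! ### Finite flat dimension and localization -/

/-- `M` has a finite resolution by flat modules. -/
inductive HasFiniteFlatDim (R : Type u) [CommRing R] :
    (M : Type u) → [AddCommGroup M] → [Module R M] → Prop
  | of_flat (M : Type u) [AddCommGroup M] [Module R M] (hM : Module.Flat R M) :
      HasFiniteFlatDim R M
  | of_exact (K F M : Type u) [AddCommGroup K] [Module R K] [AddCommGroup F] [Module R F]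
      [AddCommGroup M] [Module R M] (ι : K →ₗ[R] F) (π : F →ₗ[R] M)
      (hι : Function.Injective ι) (hex : Function.Exact ι π) (hπ : Function.Surjective π)
      (hF : Module.Flat R F) (hK : HasFiniteFlatDim R K) : HasFiniteFlatDim R M

theorem HasFiniteFlatDim.of_surjective {R : Type u} [CommRing R] {F M : Type u} [AddCommGroup F]
    [Module R F] [AddCommGroup M] [Module R M] (π : F →ₗ[R] M) (hπ : Function.Surjective π)
    [hF : Module.Flat R F] (hK : HasFiniteFlatDim R (LinearMap.ker π)) : HasFiniteFlatDim R M :=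
  .of_exact _ F M (LinearMap.ker π).subtype π (Submodule.subtype_injective _)
    (LinearMap.exact_subtype_ker_map π) hπ hF hK

theorem HasFlatResolutionOfLength.hasFiniteFlatDim {R : Type u} [CommRing R] {M : Type u}
    [AddCommGroup M] [Module R M] {n : ℕ} (h : HasFlatResolutionOfLength R M n) :
    HasFiniteFlatDim R M := by
  obtain ⟨E, d, ε, hflat, hzero, hε, h0, hd⟩ := h
  -- `j` bounds the remaining length; for `j = 0` the module `E (i + 1)` is zero.
  have key : ∀ j i, n ≤ i + j → HasFiniteFlatDim R (LinearMap.range (d i)) := by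
    intro j
    induction j with
    | zero =>
      intro i hi
      have := hzero (i + 1) (by omega)
      have : Subsingleton (LinearMap.range (d i)) :=
        (LinearMap.surjective_rangeRestrict (d i)).subsingleton
      exact .of_flat _ inferInstance
    | succ j ih =>
      intro i hi
      have := hflat (i + 1)
      refine .of_surjective (d i).rangeRestrict (LinearMap.surjective_rangeRestrict _) ?_
      rw [LinearMap.ker_rangeRestrict, (LinearMap.exact_iff.mp (hd i))]
      exact ih (i + 1) (by omega)
  have := hflat 0
  refine .of_surjective ε hε ?_
  rw [LinearMap.exact_iff.mp h0]
  exact key n 0 (by omega)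

theorem hasFlatResolutionOfLength_one {R : Type u} [CommRing R] {F M : Type u} [AddCommGroup F]
    [Module R F] [AddCommGroup M] [Module R M] (π : F →ₗ[R] M) (hπ : Function.Surjective π)
    (hF : Module.Flat R F) (hK : Module.Flat R (LinearMap.ker π)) :
    HasFlatResolutionOfLength R M 1 := by
  let E : ℕ → ModuleCat.{u} R
    | 0 => .of R F
    | 1 => .of R (LinearMap.ker π)
    | _ + 2 => .of R PUnit.{u + 1}
  let d : ∀ i, E (i + 1) →ₗ[R] E i
    | 0 => (LinearMap.ker π).subtype
    | _ + 1 => 0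
  refine ⟨E, d, π, ?_, ?_, hπ, LinearMap.exact_subtype_ker_map π, ?_⟩
  · rintro (_ | _ | i)
    · exact hF
    · exact hK
    · exact inferInstanceAs (Module.Flat R PUnit.{u + 1})
  · rintro (_ | _ | i) hi
    · omega
    · omega
    · exact inferInstanceAs (Subsingleton PUnit.{u + 1})
  · rintro (_ | i) x
    · refine ⟨fun h => ⟨0, ?_⟩, ?_⟩
      · exact (Subtype.ext h : x = (0 : LinearMap.ker π)).symm
      · rintro ⟨y, rfl⟩
        rfl
    · exact ⟨fun _ => ⟨0, Subsingleton.elim (α := PUnit.{u + 1}) _ _⟩, fun _ => rfl⟩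

theorem HasFiniteFlatDim.of_isLocalizedModule {R : Type u} [CommRing R] (S : Submonoid R)
    (A : Type u) [CommRing A] [Algebra R A] [IsLocalization S A] {M : Type u} [AddCommGroup M]
    [Module R M] (h : HasFiniteFlatDim R M) :
    ∀ (M' : Type u) [AddCommGroup M'] [Module R M'] [Module A M'] [IsScalarTower R A M']
      (f : M →ₗ[R] M') [IsLocalizedModule S f], HasFiniteFlatDim A M' := by
  induction h with
  | of_flat M hM =>
    intro M' _ _ _ _ f _
    exact .of_flat _ (Module.Flat.of_isLocalizedModule A S f)
  | of_exact K F M ι π hι hex hπ hF hK ih =>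
    intro M' _ _ _ _ f _
    let _ : Module A (LocalizedModule S K) := LocalizedModule.moduleOfIsLocalization ..
    let _ : Module A (LocalizedModule S F) := LocalizedModule.moduleOfIsLocalization ..
    let gK := LocalizedModule.mkLinearMap S K
    let gF := LocalizedModule.mkLinearMap S F
    exact .of_exact _ _ M'
      ((IsLocalizedModule.map S gK gF ι).extendScalarsOfIsLocalization S A)
      ((IsLocalizedModule.map S gF f π).extendScalarsOfIsLocalization S A)
      (IsLocalizedModule.map_injective S gK gF ι hι)
      (IsLocalizedModule.map_exact S gK gF f ι π hex)
      (IsLocalizedModule.map_surjective S gF f π hπ)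
      (Module.Flat.of_isLocalizedModule A S gF) (ih _ gK)

/-- Every module has a finite flat resolution. -/
def AllHaveFiniteFlatDim (R : Type u) [CommRing R] : Prop :=
  ∀ (M : Type u) [AddCommGroup M] [Module R M], HasFiniteFlatDim R M

theorem AllHaveFiniteFlatDim.localization {R : Type u} [CommRing R] (h : AllHaveFiniteFlatDim R)
    (S : Submonoid R) (A : Type u) [CommRing A] [Algebra R A] [IsLocalization S A] :
    AllHaveFiniteFlatDim A := by
  intro M _ _
  let _ : Module R M := Module.compHom M (algebraMap R A)
  have : IsScalarTower R A M := ⟨fun x y z => by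
    rw [Algebra.smul_def, mul_smul]; rfl⟩
  -- An `A`-module, restricted to `R`, is its own localization.
  have := isLocalizedModule_id S M A
  exact (h M).of_isLocalizedModule S A M (LinearMap.id : M →ₗ[R] M)

theorem allHaveFiniteFlatDim_of_weakGlobalDim_ne_top {R : Type u} [CommRing R]
    (h : weakGlobalDim R ≠ ⊤) : AllHaveFiniteFlatDim R := by
  intro M _ _
  by_contra hM
  apply h
  rw [eq_top_iff]
  refine le_trans ?_ (le_iSup (fun M : ModuleCat.{u} R => weakDim R M) (ModuleCat.of R M))
  exact le_iInf₂ fun n hn => absurd hn.hasFiniteFlatDim hM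

theorem weakGlobalDim_le_one {R : Type u} [CommRing R]
    (h : ∀ (F : Type u) [AddCommGroup F] [Module R F] [Module.Flat R F] (K : Submodule R F),
      Module.Flat R K) : weakGlobalDim R ≤ 1 := by
  refine iSup_le fun M => iInf₂_le_of_le 1 ?_ le_rfl
  exact hasFlatResolutionOfLength_one (Finsupp.linearCombination R (id : M → M))
    (Finsupp.linearCombination_id_surjective R M) inferInstance (h _ _)

/-! ### Relative projectivity and two-generated ideals -/

theorem IsRelProjective.exists_lift {R P M X : Type*} [CommRing R] [AddCommGroup P] [Module R P]
    [AddCommGroup M] [Module R M] [AddCommGroup X] [Module R X] (h : IsRelProjective R P M)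
    (g : M →ₗ[R] X) (hg : Function.Surjective g) (f : P →ₗ[R] X) :
    ∃ l : P →ₗ[R] M, g ∘ₗ l = f := by
  let e := g.quotKerEquivOfSurjective hg
  obtain ⟨l, hl⟩ := h (LinearMap.ker g) (e.symm.toLinearMap ∘ₗ f)
  refine ⟨l, LinearMap.ext fun x => ?_⟩
  have := congrArg e (LinearMap.congr_fun hl x)
  simpa [e] using this

theorem IsRelProjective.of_injective {R P M L : Type*} [CommRing R] [AddCommGroup P] [Module R P]
    [AddCommGroup M] [Module R M] [AddCommGroup L] [Module R L] (h : IsRelProjective R P M)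
    (i : L →ₗ[R] M) (hi : Function.Injective i) : IsRelProjective R P L := by
  intro N f
  let j : (L ⧸ N) →ₗ[R] (M ⧸ N.map i) := N.mapQ (N.map i) i (Submodule.le_comap_map i N)
  obtain ⟨l, hl⟩ := h (N.map i) (j ∘ₗ f)
  have hl' : ∀ x, (N.map i).mkQ (l x) = j (f x) := LinearMap.congr_fun hl
  -- The lift into `M` already takes values in the image of `L`, because it agrees with an element
  -- of that image modulo `N.map i`.
  have hr : ∀ x, ∃ y, i y = l x ∧ N.mkQ y = f x := by
    intro x
    obtain ⟨z, hz⟩ := N.mkQ_surjective (f x)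
    have h1 : (N.map i).mkQ (l x - i z) = 0 := by
      rw [map_sub, hl', ← hz]
      simp [j]
    rw [Submodule.mkQ_apply, Submodule.Quotient.mk_eq_zero] at h1
    obtain ⟨n, hn, hn'⟩ := h1
    refine ⟨z + n, by rw [map_add, hn']; abel, ?_⟩
    rw [map_add, hz, Submodule.mkQ_apply N n, (Submodule.Quotient.mk_eq_zero N).mpr hn, add_zero]
  have hrange : ∀ x, l x ∈ LinearMap.range i := fun x => let ⟨y, hy, _⟩ := hr x; ⟨y, hy⟩
  let e := LinearEquiv.ofInjective i hi
  refine ⟨e.symm.toLinearMap ∘ₗ l.codRestrict _ hrange, LinearMap.ext fun x => ?_⟩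
  obtain ⟨y, hy, hy'⟩ := hr x
  have : l.codRestrict _ hrange x = e y := Subtype.ext hy.symm
  simp only [LinearMap.comp_apply, LinearEquiv.coe_coe, this, LinearEquiv.symm_apply_apply]
  exact hy'

theorem IsRelProjective.prod {R P M L : Type*} [CommRing R] [AddCommGroup P] [Module R P]
    [AddCommGroup M] [Module R M] [AddCommGroup L] [Module R L] (hM : IsRelProjective R P M)
    (hL : IsRelProjective R P L) : IsRelProjective R P (M × L) := by
  intro N f
  let g1 : M →ₗ[R] (M × L) ⧸ N := N.mkQ ∘ₗ LinearMap.inl R M L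
  let g2 : L →ₗ[R] (M × L) ⧸ N := N.mkQ ∘ₗ LinearMap.inr R M L
  let W := LinearMap.range g1
  have hsurj : Function.Surjective (W.mkQ ∘ₗ g2) := by
    intro x
    obtain ⟨x, rfl⟩ := W.mkQ_surjective x
    obtain ⟨⟨m, l⟩, rfl⟩ := N.mkQ_surjective x
    refine ⟨l, ?_⟩
    rw [LinearMap.comp_apply, Submodule.mkQ_apply, Submodule.mkQ_apply, Submodule.Quotient.eq]
    refine ⟨-m, ?_⟩
    change N.mkQ (-m, 0) = N.mkQ (0, l) - N.mkQ (m, l)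
    rw [← map_sub]
    simp
  obtain ⟨l2, hl2⟩ := hL.exists_lift _ hsurj (W.mkQ ∘ₗ f)
  have hW : ∀ x, (f - g2 ∘ₗ l2) x ∈ W := by
    intro x
    rw [← Submodule.Quotient.mk_eq_zero, ← Submodule.mkQ_apply, LinearMap.sub_apply, map_sub,
      sub_eq_zero]
    exact (LinearMap.congr_fun hl2 x).symm
  obtain ⟨l1, hl1⟩ := hM.exists_lift g1.rangeRestrict (LinearMap.surjective_rangeRestrict _)
    ((f - g2 ∘ₗ l2).codRestrict W hW)
  refine ⟨l1.prod l2, LinearMap.ext fun x => ?_⟩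
  have h1 : g1 (l1 x) = f x - g2 (l2 x) := congrArg Subtype.val (LinearMap.congr_fun hl1 x)
  have h2 : N.mkQ (l1 x, l2 x) = g1 (l1 x) + g2 (l2 x) := by
    simp only [g1, g2, LinearMap.comp_apply, ← map_add]
    simp
  change N.mkQ (l1 x, l2 x) = f x
  rw [h2, h1, sub_add_cancel]

/-- Every ideal `(a, b)` of `R` has a dual basis over `R` modulo its annihilator: `p₁, q₁` and
`p₂, q₂` are the values at `a, b` of two functionals. -/
def HasPairDualBases (R : Type*) [CommRing R] : Prop :=
  ∀ a b : R, ∃ p₁ p₂ q₁ q₂ : R, a = p₁ * a + p₂ * b ∧ b = q₁ * a + q₂ * b ∧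
    ∀ x y : R, x * a + y * b = 0 →
      ((x * p₁ + y * q₁) * a = 0 ∧ (x * p₁ + y * q₁) * b = 0) ∧
      ((x * p₂ + y * q₂) * a = 0 ∧ (x * p₂ + y * q₂) * b = 0)

/-- With `J` the annihilator of `I = (a, b)`, the map `r ↦ (ra, rb)` embeds `R/J` in `I × I`. So `I`
is projective relative to `(R/J)²`, and the surjection `(R/J)² → I` splits; the coordinates of the
splitting are the functionals. -/
theorem IsFqpRing.hasPairDualBases {R : Type*} [CommRing R] (h : IsFqpRing R) :
    HasPairDualBases R := by
  intro a b
  let I : Ideal R := Ideal.span {a, b}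
  let a' : I := ⟨a, Ideal.subset_span (by simp)⟩
  let b' : I := ⟨b, Ideal.subset_span (by simp)⟩
  have hI : IsRelProjective R I I := h I (Submodule.fg_span (Set.toFinite _))
  let u : R →ₗ[R] I × I := LinearMap.toSpanSingleton R (I × I) (a', b')
  let J := LinearMap.ker u
  have hJ : ∀ r, r ∈ J ↔ r * a = 0 ∧ r * b = 0 := by
    intro r
    simp [J, u, a', b', Subtype.ext_iff, Prod.ext_iff]
  have hQ : IsRelProjective R I (R ⧸ J) :=
    (hI.prod hI).of_injective (J.liftQ u le_rfl) (LinearMap.ker_eq_bot.mp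
      (Submodule.ker_liftQ_eq_bot _ _ _ le_rfl))
  have hva : J ≤ LinearMap.ker (LinearMap.toSpanSingleton R I a') := fun r hr =>
    Subtype.ext ((hJ r).mp hr).1
  have hvb : J ≤ LinearMap.ker (LinearMap.toSpanSingleton R I b') := fun r hr =>
    Subtype.ext ((hJ r).mp hr).2
  let g : (R ⧸ J) × (R ⧸ J) →ₗ[R] I := (J.liftQ _ hva).coprod (J.liftQ _ hvb)
  have hg : ∀ r s : R, (g (J.mkQ r, J.mkQ s) : R) = r * a + s * b :=
    fun _ _ => rfl
  have hgs : Function.Surjective g := by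
    rintro ⟨z, hz⟩
    obtain ⟨r, s, rfl⟩ := Ideal.mem_span_pair.mp hz
    exact ⟨(J.mkQ r, J.mkQ s), Subtype.ext (hg r s)⟩
  obtain ⟨l, hl⟩ := (hQ.prod hQ).exists_lift g hgs LinearMap.id
  obtain ⟨p₁, hp₁⟩ := J.mkQ_surjective (l a').1
  obtain ⟨p₂, hp₂⟩ := J.mkQ_surjective (l a').2
  obtain ⟨q₁, hq₁⟩ := J.mkQ_surjective (l b').1
  obtain ⟨q₂, hq₂⟩ := J.mkQ_surjective (l b').2
  have hla : l a' = (J.mkQ p₁, J.mkQ p₂) := Prod.ext hp₁.symm hp₂.symm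
  have hlb : l b' = (J.mkQ q₁, J.mkQ q₂) := Prod.ext hq₁.symm hq₂.symm
  have hl' : ∀ z, g (l z) = z := LinearMap.congr_fun hl
  refine ⟨p₁, p₂, q₁, q₂, ?_, ?_, fun x y hxy => ?_⟩
  · rw [← hg, ← hla, hl']
  · rw [← hg, ← hlb, hl']
  · have h0 : x • a' + y • b' = 0 := Subtype.ext hxy
    have h1 : l (x • a' + y • b') = (J.mkQ (x * p₁ + y * q₁), J.mkQ (x * p₂ + y * q₂)) := by
      simp only [map_add, map_smul, hla, hlb, Prod.smul_mk, Prod.mk_add_mk, ← smul_eq_mul]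
    rw [h0, map_zero] at h1
    have h2 := (Prod.ext_iff.mp h1.symm).1
    have h3 := (Prod.ext_iff.mp h1.symm).2
    simp only [Submodule.mkQ_apply, Prod.fst_zero, Prod.snd_zero,
      Submodule.Quotient.mk_eq_zero] at h2 h3
    exact ⟨(hJ _).mp h2, (hJ _).mp h3⟩

theorem HasPairDualBases.localization {R : Type*} [CommRing R] (h : HasPairDualBases R)
    (S : Submonoid R) (A : Type*) [CommRing A] [Algebra R A] [IsLocalization S A] :
    HasPairDualBases A := by
  intro a' b'
  obtain ⟨a, b, s, ha, hb⟩ := IsLocalization.surj₂ S A a' b'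
  obtain ⟨p₁, p₂, q₁, q₂, h1, h2, h3⟩ := h a b
  have hs : IsUnit (algebraMap R A s) := IsLocalization.map_units A s
  let φ := algebraMap R A
  refine ⟨φ p₁, φ p₂, φ q₁, φ q₂, ?_, ?_, fun x' y' hxy => ?_⟩
  · apply hs.mul_right_cancel
    have := congrArg φ h1
    rw [map_add, map_mul, map_mul] at this
    linear_combination ha + this - φ p₁ * ha - φ p₂ * hb
  · apply hs.mul_right_cancel
    have := congrArg φ h2
    rw [map_add, map_mul, map_mul] at this
    linear_combination hb + this - φ q₁ * ha - φ q₂ * hb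
  · obtain ⟨x, y, t, hx, hy⟩ := IsLocalization.surj₂ S A x' y'
    have ht : IsUnit (algebraMap R A t) := IsLocalization.map_units A t
    have h0 : algebraMap R A (x * a + y * b) = 0 := by
      rw [map_add, map_mul, map_mul, ← hx, ← hy, ← ha, ← hb]
      linear_combination φ t * φ s * hxy
    obtain ⟨c, hc⟩ := (IsLocalization.map_eq_zero_iff S A _).mp h0
    have hcu : IsUnit (algebraMap R A c) := IsLocalization.map_units A c
    have h4 := h3 (c * x) (c * y) (by linear_combination hc)
    have key : ∀ p q z : R, ∀ z' : A, z' * φ s = φ z → (c * x * p + c * y * q) * z = 0 →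
        (x' * φ p + y' * φ q) * z' = 0 := by
      intro p q z z' hz h5
      have h6 := congrArg φ h5
      simp only [map_mul, map_add, map_zero] at h6
      apply ((hs.mul ht).mul hcu).mul_right_cancel
      linear_combination h6 + φ p * z' * φ s * φ c * hx + φ q * z' * φ s * φ c * hy +
        (φ x * φ p + φ y * φ q) * φ c * hz
    exact ⟨⟨key _ _ _ _ ha h4.1.1, key _ _ _ _ hb h4.1.2⟩,
      ⟨key _ _ _ _ ha h4.2.1, key _ _ _ _ hb h4.2.2⟩⟩

/-! ### Pairs of elements in a local ring -/

/-- Of any two elements either one divides the other, or they have the same annihilator and are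
linearly independent modulo it. -/
def IsDvdOrIndep (R : Type*) [CommRing R] : Prop :=
  ∀ a b : R, a ∣ b ∨ b ∣ a ∨
    ∀ x y : R, x * a + y * b = 0 → (x * a = 0 ∧ x * b = 0) ∧ (y * a = 0 ∧ y * b = 0)

/-- The matrix of `p`'s and `q`'s fixes the column `(a, b)` and sends each relation row into the
annihilator of `(a, b)`. Either one of its entries yields a divisibility, or it is invertible and
the relation itself has entries in the annihilator. -/
theorem HasPairDualBases.isDvdOrIndep {R : Type*} [CommRing R] [IsLocalRing R]
    (h : HasPairDualBases R) : IsDvdOrIndep R := by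
  intro a b
  obtain ⟨p₁, p₂, q₁, q₂, h1, h2, h3⟩ := h a b
  rcases IsLocalRing.isUnit_or_isUnit_one_sub_self p₁ with hp₁ | hp₁
  swap
  · right; left
    obtain ⟨u, hu⟩ := hp₁.exists_left_inv
    exact ⟨u * p₂, by linear_combination (-a) * hu + u * h1⟩
  rcases IsLocalRing.isUnit_or_isUnit_one_sub_self q₂ with hq₂ | hq₂
  swap
  · left
    obtain ⟨u, hu⟩ := hq₂.exists_left_inv
    exact ⟨u * q₁, by linear_combination (-b) * hu + u * h2⟩
  by_cases hp₂ : IsUnit p₂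
  · left
    obtain ⟨u, hu⟩ := hp₂.exists_left_inv
    exact ⟨u * (1 - p₁), by linear_combination (-b) * hu - u * h1⟩
  right; right
  have hdet : IsUnit (p₁ * q₂ - p₂ * q₁) := by
    by_contra hd
    have : p₁ * q₂ ∈ nonunits R := by
      have := IsLocalRing.nonunits_add (a := p₁ * q₂ - p₂ * q₁) (b := p₂ * q₁) hd
        (fun hu => hp₂ (isUnit_of_mul_isUnit_left hu))
      simpa using this
    exact this (hp₁.mul hq₂)
  obtain ⟨u, hu⟩ := hdet.exists_left_inv
  intro x y hxy
  obtain ⟨⟨h4, h5⟩, h6, h7⟩ := h3 x y hxy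
  refine ⟨⟨?_, ?_⟩, ?_, ?_⟩
  · linear_combination (-x * a) * hu + u * q₂ * h4 - u * q₁ * h6
  · linear_combination (-x * b) * hu + u * q₂ * h5 - u * q₁ * h7
  · linear_combination (-y * a) * hu + u * p₁ * h6 - u * p₂ * h4
  · linear_combination (-y * b) * hu + u * p₁ * h7 - u * p₂ * h5

/-! ### Local rings whose maximal ideal has square zero -/

theorem Module.Flat.mem_torsionOf_smul_top {R M : Type*} [CommRing R] [AddCommGroup M]
    [Module R M] [Module.Flat R M] {r : R} {m : M} (h : r • m = 0) :
    m ∈ Ideal.torsionOf R R r • (⊤ : Submodule R M) := by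
  obtain ⟨κ, c, y, hy, hc⟩ := Module.Flat.isTrivialRelation_of_sum_smul_eq_zero
    (R := R) (ι := Unit) (f := fun _ => r) (x := fun _ => m) (by simpa using h)
  rw [show m = _ from hy ()]
  refine Submodule.sum_mem _ fun j _ => Submodule.smul_mem_smul ?_ trivial
  simpa [mul_comm] using hc j

theorem exists_linearMap_residue_eq_one {R : Type*} [CommRing R] [IsLocalRing R]
    (hsq : ∀ x ∈ maximalIdeal R, ∀ y ∈ maximalIdeal R, x * y = 0) (a : maximalIdeal R)
    (ha : a ≠ 0) : ∃ φ : maximalIdeal R →ₗ[R] R ⧸ maximalIdeal R, φ a = 1 := by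
  have ht : Module.IsTorsionBySet R (maximalIdeal R) (maximalIdeal R : Set R) :=
    fun y x => Subtype.ext (hsq x x.2 y y.2)
  let _ : Module (R ⧸ maximalIdeal R) (maximalIdeal R) := ht.module
  let _ : Field (R ⧸ maximalIdeal R) := Ideal.Quotient.field _
  have := ht.isScalarTower (S := R)
  obtain ⟨φ, hφ⟩ := Module.Projective.exists_dual_eq_one (R ⧸ maximalIdeal R) ha
  exact ⟨φ.restrictScalars R, hφ⟩

/-- Write `𝔪` for the maximal ideal. If `a • f = ι k` then `a • k = 0`, so by induction `k` comes
from some `τ` in `𝔪 ⊗ K`. Flatness of `F` identifies the image of `τ` in `𝔪 ⊗ F` with `a ⊗ f`;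
applying `φ ⊗ π` with `φ a = 1` kills that image and leaves `1 ⊗ π f = 0`. -/
theorem HasFiniteFlatDim.mem_maximalIdeal_smul_top {R : Type u} [CommRing R] [IsLocalRing R]
    (hsq : ∀ x ∈ maximalIdeal R, ∀ y ∈ maximalIdeal R, x * y = 0) {a : R}
    (ham : a ∈ maximalIdeal R) (ha : a ≠ 0) {M : Type u} [AddCommGroup M] [Module R M]
    (h : HasFiniteFlatDim R M) :
    ∀ m : M, a • m = 0 → m ∈ maximalIdeal R • (⊤ : Submodule R M) := by
  induction h with
  | of_flat M hM =>
    intro m hm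
    refine Submodule.smul_mono_left (fun x hx => ?_) (Module.Flat.mem_torsionOf_smul_top hm)
    by_contra hx'
    have hu : IsUnit x := by simpa using hx'
    exact ha (hu.mul_right_eq_zero.mp (by simpa using hx))
  | of_exact K F M ι π hι hex hπ hF hK ih =>
    intro m hm
    obtain ⟨f, rfl⟩ := hπ m
    obtain ⟨k, hk⟩ := (hex (a • f)).mp (by rw [map_smul, hm])
    have hak : a • k = 0 := hι (by
      rw [map_smul, hk, smul_smul, hsq a ham a ham, zero_smul, map_zero])
    have hk' : ∃ τ : maximalIdeal R ⊗[R] K,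
        TensorProduct.lid R K ((maximalIdeal R).subtype.rTensor K τ) = k := by
      refine Submodule.smul_induction_on (ih k hak) (fun r hr n _ => ⟨⟨r, hr⟩ ⊗ₜ n, by simp⟩) ?_
      rintro x y ⟨τ, rfl⟩ ⟨σ, rfl⟩
      exact ⟨τ + σ, by simp⟩
    obtain ⟨τ, hτ⟩ := hk'
    have hτf : ι.lTensor (maximalIdeal R) τ = ⟨a, ham⟩ ⊗ₜ[R] f := by
      apply Module.Flat.rTensor_preserves_injective_linearMap (M := F)
        (maximalIdeal R).subtype (Submodule.subtype_injective _)
      apply (TensorProduct.lid R F).injective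
      rw [← LinearMap.comp_apply (LinearMap.rTensor F _), LinearMap.rTensor_comp_lTensor,
        ← LinearMap.lTensor_comp_rTensor, LinearMap.comp_apply]
      have hnat : ∀ t : R ⊗[R] K, TensorProduct.lid R F (ι.lTensor R t) =
          ι (TensorProduct.lid R K t) := by
        intro t
        induction t with
        | zero => simp
        | tmul x y => simp
        | add x y hx hy => simp only [map_add, hx, hy]
      rw [hnat, hτ, hk]
      simp
    obtain ⟨φ, hφ⟩ := exists_linearMap_residue_eq_one hsq ⟨a, ham⟩
      (fun h0 => ha (congrArg Subtype.val h0))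
    have hzero : (1 : R ⧸ maximalIdeal R) ⊗ₜ[R] π f = 0 := by
      have h1 := congrArg (TensorProduct.map φ π) hτf
      rw [TensorProduct.map_tmul, hφ, ← LinearMap.comp_apply, LinearMap.map_comp_lTensor,
        hex.linearMap_comp_eq_zero, TensorProduct.map_zero_right, LinearMap.zero_apply] at h1
      exact h1.symm
    have h2 := congrArg (TensorProduct.quotTensorEquivQuotSMul M (maximalIdeal R)) hzero
    rw [map_zero, ← map_one (Ideal.Quotient.mk _),
      TensorProduct.quotTensorEquivQuotSMul_mk_tmul, one_smul] at h2
    exact (Submodule.Quotient.mk_eq_zero _).mp h2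

theorem AllHaveFiniteFlatDim.eq_zero_of_maximalIdeal_sq_eq_zero {R : Type u} [CommRing R]
    [IsLocalRing R] (h : AllHaveFiniteFlatDim R)
    (hsq : ∀ x ∈ maximalIdeal R, ∀ y ∈ maximalIdeal R, x * y = 0) {a : R}
    (ham : a ∈ maximalIdeal R) : a = 0 := by
  by_contra ha
  have h1 := (h (R ⧸ maximalIdeal R)).mem_maximalIdeal_smul_top hsq ham ha
    (Ideal.Quotient.mk _ 1) ((Submodule.Quotient.mk_eq_zero _).mpr (by simpa using ham))
  have h2 : maximalIdeal R • (⊤ : Submodule R (R ⧸ maximalIdeal R)) ≤ ⊥ := by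
    refine Submodule.smul_le.mpr fun r hr n _ => ?_
    obtain ⟨n, rfl⟩ := Ideal.Quotient.mk_surjective n
    exact (Submodule.Quotient.mk_eq_zero _).mpr (Ideal.mul_mem_right _ _ hr)
  have h3 : Ideal.Quotient.mk (maximalIdeal R) 1 = 0 := h2 h1
  rw [map_one] at h3
  exact one_ne_zero h3

/-! ### Excluding incomparable elements -/

/-- The annihilator of one of two elements neither of which divides the other is prime. -/
theorem IsDvdOrIndep.isPrime_torsionOf {R : Type*} [CommRing R] (hD : IsDvdOrIndep R) {a b : R}
    (hab : ¬ a ∣ b) (hba : ¬ b ∣ a) : (Ideal.torsionOf R R a).IsPrime := by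
  have hDab := ((hD a b).resolve_left hab).resolve_left hba
  refine ⟨fun h => hab ?_, fun {x y} hxy => ?_⟩
  · have h1 : (1 : R) ∈ Ideal.torsionOf R R a := h ▸ trivial
    have h2 : a = 0 := by simpa using h1
    have := (hDab 1 0 (by simp [h2])).1.2
    rw [one_mul] at this
    simp [this]
  · simp only [Ideal.mem_torsionOf_iff, smul_eq_mul] at hxy ⊢
    by_contra! hne
    -- The dichotomy is applied to `x * a` and `b`; in the independent case `y` kills `b`, hence
    -- `a`.
    rcases hD (x * a) b with h | ⟨r, h⟩ | h
    · exact hab ((dvd_mul_left a x).trans h)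
    · exact hne.1 (hDab x (-r) (by linear_combination h)).1.1
    · have h1 := (h y 0 (by linear_combination hxy)).1.2
      exact hne.2 (hDab 0 y (by linear_combination h1)).2.1

theorem IsDvdOrIndep.eq_zero_of_mul_eq_zero {R : Type*} [CommRing R] (hD : IsDvdOrIndep R)
    {a b x : R} (hab : ¬ a ∣ b) (hba : ¬ b ∣ a)
    (hx : x * a = 0) : x * b = 0 :=
  ((((hD a b).resolve_left hab).resolve_left hba) x 0 (by simp [hx])).1.2

theorem IsDvdOrIndep.maximalIdeal_sq_eq_zero {R : Type*} [CommRing R] [IsLocalRing R]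
    (hD : IsDvdOrIndep R) {a b : R} (hab : ¬ a ∣ b) (hba : ¬ b ∣ a)
    (ha : ∀ c ∈ maximalIdeal R, c * a = 0) :
    ∀ x ∈ maximalIdeal R, ∀ y ∈ maximalIdeal R, x * y = 0 := by
  intro d hd c hc
  have hda := ha d hd
  have hdb : d * b = 0 := hD.eq_zero_of_mul_eq_zero hab hba hda
  by_cases hac : a ∣ c
  · obtain ⟨r, rfl⟩ := hac
    linear_combination r * hda
  by_cases hca : c ∣ a
  swap
  · exact hD.eq_zero_of_mul_eq_zero hac hca hda
  by_cases hbc : b ∣ c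
  · obtain ⟨r, rfl⟩ := hbc
    linear_combination r * hdb
  by_cases hcb : c ∣ b
  swap
  · exact hD.eq_zero_of_mul_eq_zero hbc hcb hdb
  -- Now `a = c * s` and `b = c * t`. The elements `c * s` and `t` are incomparable, so `c`, which
  -- kills the first, kills the second, giving `b = 0`.
  exfalso
  obtain ⟨s, rfl⟩ := hca
  obtain ⟨t, rfl⟩ := hcb
  have hst : ¬ s ∣ t := fun h => hab (mul_dvd_mul_left c h)
  have hts : ¬ t ∣ s := fun h => hba (mul_dvd_mul_left c h)
  have h1 : ¬ c * s ∣ t := fun h => hst ((dvd_mul_left s c).trans h)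
  have h2 : ¬ t ∣ c * s := by
    rintro ⟨r, hr⟩
    have := ((((hD s t).resolve_left hst).resolve_left hts) c (-r)
      (by linear_combination hr)).1.1
    exact hba (this ▸ dvd_zero _)
  have h3 : c * t = 0 := hD.eq_zero_of_mul_eq_zero h1 h2 (ha c hc)
  exact hab (h3 ▸ dvd_zero _)

theorem AllHaveFiniteFlatDim.dvd_total {R : Type u} [CommRing R] (h : AllHaveFiniteFlatDim R)
    [IsLocalRing R] (hP : HasPairDualBases R) (a b : R) : a ∣ b ∨ b ∣ a := by
  by_contra! hne
  obtain ⟨hab, hba⟩ := hne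
  have hD := hP.isDvdOrIndep
  let Q := Ideal.torsionOf R R a
  have hQ : Q.IsPrime := hD.isPrime_torsionOf hab hba
  have hDab := ((hD a b).resolve_left hab).resolve_left hba
  let A := Localization.AtPrime Q
  let φ := algebraMap R A
  have hmem : ∀ {x : R}, x * a = 0 → x ∈ Q := fun hx => hx
  -- The maximal ideal of `A` is generated by the image of `Q`, which kills `a`.
  have haA : ∀ c ∈ maximalIdeal A, c * φ a = 0 := by
    intro c hc
    obtain ⟨⟨x, s⟩, hx⟩ := IsLocalization.surj Q.primeCompl c
    have hs : IsUnit (φ s) := IsLocalization.map_units A s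
    have hxm : φ x ∈ maximalIdeal A := hx ▸ Ideal.mul_mem_right _ _ hc
    have hxQ : x * a = 0 := (IsLocalization.AtPrime.to_map_mem_maximal_iff A Q x).mp hxm
    apply hs.mul_right_cancel
    have := congrArg φ hxQ
    rw [map_mul, map_zero] at this
    linear_combination φ a * hx + this
  have hdvd : ∀ u v : R, φ u ∣ φ v → ∃ s ∉ Q, ∃ x, s * v = x * u := by
    rintro u v ⟨r, hr⟩
    obtain ⟨⟨x, s⟩, hx⟩ := IsLocalization.surj Q.primeCompl r
    have h1 : φ (s * v) = φ (x * u) := by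
      rw [map_mul, map_mul, hr]
      linear_combination φ u * hx
    obtain ⟨c, hc⟩ := IsLocalization.exists_of_eq (M := Q.primeCompl) h1
    exact ⟨c * s, Q.primeCompl.mul_mem c.2 s.2, c * x, by linear_combination hc⟩
  have habA : ¬ φ a ∣ φ b := by
    intro hd
    obtain ⟨s, hs, x, hx⟩ := hdvd _ _ hd
    exact hs (neg_mem_iff.mp (hmem (hDab x (-s) (by linear_combination -hx)).2.1))
  have hbaA : ¬ φ b ∣ φ a := by
    intro hd
    obtain ⟨s, hs, x, hx⟩ := hdvd _ _ hd
    exact hs (hmem (hDab s (-x) (by linear_combination hx)).1.1)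
  have hDA := (hP.localization Q.primeCompl A).isDvdOrIndep
  have hsq := hDA.maximalIdeal_sq_eq_zero habA hbaA haA
  have ham : φ a ∈ maximalIdeal A := fun hu => habA hu.dvd
  have h0 := (h.localization Q.primeCompl A).eq_zero_of_maximalIdeal_sq_eq_zero hsq ham
  exact hbaA (h0 ▸ dvd_zero _)

/-! ### Total chain rings: flatness of the maximal ideal -/

/-- Divisibility is total and every nonunit is a zero-divisor. -/
structure IsTotalChainRing (R : Type*) [CommRing R] : Prop where
  dvd_total (a b : R) : a ∣ b ∨ b ∣ a
  exists_mul_eq_zero (t : R) : ¬ IsUnit t → ∃ n, n ≠ 0 ∧ t * n = 0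

theorem IsTotalChainRing.dvd_of_annihilator_le {R : Type*} [CommRing R] (hR : IsTotalChainRing R)
    {t w : R} (h : ∀ x, x * t = 0 → x * w = 0) : t ∣ w := by
  refine (hR.dvd_total t w).elim id ?_
  rintro ⟨m, rfl⟩
  by_cases hm : IsUnit m
  · exact hm.dvd_mul_right.mp dvd_rfl
  obtain ⟨n, hn, hmn⟩ := hR.exists_mul_eq_zero m hm
  rcases hR.dvd_total w n with ⟨q, rfl⟩ | ⟨q, rfl⟩
  · refine absurd ?_ hn
    linear_combination h q (by linear_combination hmn)
  · have h1 : n * q * m = 0 := by linear_combination q * hmn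
    simpa [h1] using h 1

/-- Multiplication by `r` and `x` alternately gives a periodic free resolution of `R/(r)`, and the
claim is that the resulting Tor vanishes. Passing to a syzygy swaps `r` and `x`, so both statements
are proved together. -/
theorem HasFiniteFlatDim.dvd_of_smul_eq_zero {R : Type u} [CommRing R] {r x : R}
    (hr : ∀ y, y * r = 0 ↔ x ∣ y) (hx : ∀ y, y * x = 0 ↔ r ∣ y) {M : Type u} [AddCommGroup M]
    [Module R M] (h : HasFiniteFlatDim R M) :
    ∀ m : M, (r • m = 0 → ∃ m', m = x • m') ∧ (x • m = 0 → ∃ m', m = r • m') := by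
  have hflat : ∀ (M : Type u) [AddCommGroup M] [Module R M] [Module.Flat R M] (r x : R)
      (_ : ∀ y, y * r = 0 ↔ x ∣ y) (m : M), r • m = 0 → ∃ m', m = x • m' := by
    intro M _ _ _ r x hr m hm
    refine Submodule.smul_induction_on (Module.Flat.mem_torsionOf_smul_top hm) ?_ ?_
    · intro y hy n _
      obtain ⟨c, rfl⟩ := (hr y).mp hy
      exact ⟨c • n, mul_smul _ _ _⟩
    · rintro _ _ ⟨p, rfl⟩ ⟨q, rfl⟩
      exact ⟨p + q, (smul_add _ _ _).symm⟩
  have hxr : x * r = 0 := (hr x).mpr dvd_rfl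
  induction h with
  | of_flat M hM => exact fun m => ⟨hflat M r x hr m, hflat M x r hx m⟩
  | of_exact K F M ι π hι hex hπ hF hK ih =>
    have key : ∀ (r x : R) (_ : ∀ y, y * r = 0 ↔ x ∣ y) (_ : x * r = 0)
        (_ : ∀ k : K, x • k = 0 → ∃ k', k = r • k') (m : M), r • m = 0 → ∃ m', m = x • m' := by
      intro r x hr hxr ih m hm
      obtain ⟨f, rfl⟩ := hπ m
      obtain ⟨k, hk⟩ := (hex (r • f)).mp (by rw [map_smul, hm])
      have hxk : x • k = 0 := hι (by rw [map_smul, hk, smul_smul, hxr, zero_smul, map_zero])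
      obtain ⟨k', rfl⟩ := ih k hxk
      obtain ⟨f', hf'⟩ := hflat F r x hr (f - ι k') (by rw [smul_sub, ← hk, map_smul, sub_self])
      refine ⟨π f', ?_⟩
      rw [← map_smul, ← hf', map_sub, (hex _).mpr ⟨k', rfl⟩, sub_zero]
    exact fun m => ⟨key r x hr hxr (fun k => (ih k).2) m,
      key x r hx (by rw [mul_comm, hxr]) (fun k => (ih k).1) m⟩

theorem AllHaveFiniteFlatDim.isUnit_of_annihilator_eq {R : Type u} [CommRing R] [IsLocalRing R]
    (h : AllHaveFiniteFlatDim R) {r x : R} (hr : ∀ y, y * r = 0 ↔ x ∣ y)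
    (hx : ∀ y, y * x = 0 ↔ r ∣ y) (hrm : ¬ IsUnit r) : IsUnit x := by
  obtain ⟨m', hm'⟩ := ((h (R ⧸ maximalIdeal R)).dvd_of_smul_eq_zero hr hx
    (Ideal.Quotient.mk _ 1)).1 ((Submodule.Quotient.mk_eq_zero _).mpr (by simpa using hrm))
  obtain ⟨n, rfl⟩ := Ideal.Quotient.mk_surjective m'
  by_contra hxm
  have h1 : x • Ideal.Quotient.mk (maximalIdeal R) n = 0 :=
    (Submodule.Quotient.mk_eq_zero _).mpr (Ideal.mul_mem_right _ _ hxm)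
  rw [h1, map_one] at hm'
  exact one_ne_zero hm'

theorem IsBezout.of_dvd_total {R : Type*} [CommRing R] (hR : ∀ a b : R, a ∣ b ∨ b ∣ a) :
    IsBezout R := by
  rw [IsBezout.iff_span_pair_isPrincipal]
  intro x y
  rcases hR x y with h | h
  · refine ⟨x, le_antisymm (Ideal.span_le.mpr ?_) (Ideal.span_mono (by simp))⟩
    rintro z (rfl | rfl)
    exacts [Ideal.mem_span_singleton_self z, Ideal.mem_span_singleton.mpr h]
  · refine ⟨y, le_antisymm (Ideal.span_le.mpr ?_) (Ideal.span_mono (by simp))⟩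
    rintro z (rfl | rfl)
    exacts [Ideal.mem_span_singleton.mpr h, Ideal.mem_span_singleton_self z]

/-- Over a ring with total divisibility, flatness is a condition on single elements. -/
theorem Module.Flat.of_dvd_total {R M : Type*} [CommRing R] [AddCommGroup M] [Module R M]
    (hR : ∀ a b : R, a ∣ b ∨ b ∣ a)
    (h : ∀ (r : R) (m : M), r • m = 0 → ∃ y n, y * r = 0 ∧ m = y • n) : Module.Flat R M := by
  have := IsBezout.of_dvd_total hR
  rw [Module.Flat.iff_rTensor_injective]
  intro I hI
  obtain ⟨r, rfl⟩ := (IsBezout.isPrincipal_of_FG I hI).principal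
  rw [injective_iff_map_eq_zero]
  intro t ht
  let r' : Submodule.span R {r} := ⟨r, Submodule.mem_span_singleton_self r⟩
  have hpure : ∀ t : Submodule.span R {r} ⊗[R] M, ∃ m : M, t = r' ⊗ₜ m := by
    intro t
    induction t with
    | zero => exact ⟨0, by simp⟩
    | tmul x y =>
      obtain ⟨x, hx⟩ := x
      obtain ⟨c, rfl⟩ := Submodule.mem_span_singleton.mp hx
      exact ⟨c • y, by rw [← smul_tmul]; rfl⟩
    | add x y hx hy =>
      obtain ⟨m, rfl⟩ := hx
      obtain ⟨n, rfl⟩ := hy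
      exact ⟨m + n, (tmul_add _ _ _).symm⟩
  obtain ⟨m, rfl⟩ := hpure t
  have hrm : r • m = 0 := by
    simpa [r'] using congrArg (TensorProduct.lid R M) ht
  obtain ⟨y, n, hy, rfl⟩ := h r m hrm
  have : y • r' = 0 := Subtype.ext hy
  rw [← smul_tmul, this, zero_tmul]

theorem IsTotalChainRing.flat_maximalIdeal {R : Type u} [CommRing R] [IsLocalRing R]
    (hR : IsTotalChainRing R) (h : AllHaveFiniteFlatDim R) :
    Module.Flat R (maximalIdeal R) := by
  refine .of_dvd_total hR.dvd_total ?_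
  rintro r ⟨x, hx⟩ hrx
  have hrx' : r * x = 0 := congrArg Subtype.val hrx
  by_cases hr : IsUnit r
  · exact ⟨0, 0, zero_mul _, Subtype.ext (by simpa using hr.mul_right_eq_zero.mp hrx')⟩
  -- Otherwise `r` and `x` generate each other's annihilators, which the residue field forbids for
  -- nonunits.
  have : ∃ y, y * r = 0 ∧ ¬ x ∣ y := by
    by_contra! hne
    have h1 : ∀ y, y * r = 0 ↔ x ∣ y := fun y => ⟨hne y, by
      rintro ⟨c, rfl⟩
      linear_combination c * hrx'⟩
    have h2 : ∀ y, y * x = 0 ↔ r ∣ y := fun y => ⟨fun hy => hR.dvd_of_annihilator_le fun z hz => by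
      obtain ⟨c, rfl⟩ := hne z hz
      linear_combination c * hy, by
      rintro ⟨c, rfl⟩
      linear_combination c * hrx'⟩
    exact hx (h.isUnit_of_annihilator_eq h1 h2 hr)
  obtain ⟨y, hy, hxy⟩ := this
  obtain ⟨z, rfl⟩ := (hR.dvd_total x y).resolve_left hxy
  have hz : z ∈ maximalIdeal R := fun hu => hxy (hu.mul_right_dvd.mpr dvd_rfl)
  exact ⟨y, ⟨z, hz⟩, hy, rfl⟩

/-- The annihilators of `w * v` with `w * v ≠ 0` exhaust the maximal ideal. -/
theorem IsTotalChainRing.exists_mul_ne_zero {R : Type*} [CommRing R] [IsLocalRing R]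
    (hR : IsTotalChainRing R) {w z : R} (hw : w ≠ 0) (hz : ¬ IsUnit z) :
    ∃ v, w * v ≠ 0 ∧ z * (w * v) = 0 := by
  by_contra! hne
  -- Failure would make the annihilator of `z * w` kill `w`; a Nakayama argument then gives `w = 0`.
  have : z * w ∣ w := hR.dvd_of_annihilator_le fun x hx => by
    by_contra h0
    exact hne x (fun h => h0 (by linear_combination h)) (by linear_combination hx)
  obtain ⟨c, hc⟩ := this
  rcases isUnit_or_isUnit_one_sub_self z with hu | hu
  · exact hz hu
  have : IsUnit (1 - z * c) := by
    rcases isUnit_or_isUnit_one_sub_self (z * c) with h | h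
    · exact absurd (isUnit_of_mul_isUnit_left h) hz
    · exact h
  exact hw (this.mul_right_eq_zero.mp (by linear_combination hc))

/-! ### Flatness of annihilators -/

/-- In terms of Tor, `hX` says `Tor₁(X'', M) = 0`. -/
theorem rTensor_injective_of_exact {R : Type*} [CommRing R] {X' X X'' K F M : Type*}
    [AddCommGroup X'] [Module R X'] [AddCommGroup X] [Module R X] [AddCommGroup X'']
    [Module R X''] [AddCommGroup K] [Module R K] [AddCommGroup F] [Module R F] [AddCommGroup M]
    [Module R M] {i : X' →ₗ[R] X} {p : X →ₗ[R] X''} {ι : K →ₗ[R] F} {π : F →ₗ[R] M}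
    (hi : Function.Injective i) (hip : Function.Exact i p) (hp : Function.Surjective p)
    (hex : Function.Exact ι π) (hπ : Function.Surjective π) [Module.Flat R F]
    (hX : Function.Injective (ι.lTensor X'')) : Function.Injective (i.rTensor M) := by
  rw [injective_iff_map_eq_zero]
  intro ξ hξ
  obtain ⟨f, rfl⟩ := LinearMap.lTensor_surjective X' hπ ξ
  have h1 : π.lTensor X (i.rTensor F f) = 0 := by
    rw [← LinearMap.comp_apply, LinearMap.lTensor_comp_rTensor, ← LinearMap.rTensor_comp_lTensor,
      LinearMap.comp_apply, hξ]
  obtain ⟨k, hk⟩ := (lTensor_exact X hex hπ _).mp h1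
  have h2 : p.rTensor K k = 0 := hX (by
    rw [map_zero, ← LinearMap.comp_apply, LinearMap.lTensor_comp_rTensor,
      ← LinearMap.rTensor_comp_lTensor, LinearMap.comp_apply, hk, ← LinearMap.comp_apply,
      ← LinearMap.rTensor_comp, hip.linearMap_comp_eq_zero, LinearMap.rTensor_zero,
      LinearMap.zero_apply])
  obtain ⟨k', rfl⟩ := (rTensor_exact K hip hp _).mp h2
  have h3 : ι.lTensor X' k' = f := by
    apply Module.Flat.rTensor_preserves_injective_linearMap (M := F) i hi
    rw [← hk, ← LinearMap.comp_apply, ← LinearMap.comp_apply, LinearMap.rTensor_comp_lTensor,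
      LinearMap.lTensor_comp_rTensor]
  rw [← h3, ← LinearMap.comp_apply, ← LinearMap.lTensor_comp, hex.linearMap_comp_eq_zero,
    LinearMap.lTensor_zero, LinearMap.zero_apply]

theorem rTensor_inclusion_injective_of_directed {R : Type*} [CommRing R] {I P : Ideal R}
    (hI : I ≤ P) (N : Type*) [AddCommGroup N] [Module R N]
    (h : ∀ Q : Ideal R, Q.FG → Q ≤ P → ∃ (T : Ideal R) (_ : Q ≤ T) (hIT : I ≤ T),
      Function.Injective ((Submodule.inclusion hIT).rTensor N)) :
    Function.Injective ((Submodule.inclusion hI).rTensor N) := by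
  rw [injective_iff_map_eq_zero]
  intro x hx
  obtain ⟨J, hJ, sub⟩ := Submodule.exists_fg_le_subset_range_rTensor_subtype {x} (by simp)
  obtain ⟨y, rfl⟩ := sub rfl
  let f := Submodule.inclusion hI
  have h0 : (J.map f).subtype.rTensor N ((f.submoduleMap J).rTensor N y) = 0 := by
    rw [← LinearMap.rTensor_comp_apply]
    rw [← LinearMap.rTensor_comp_apply] at hx
    exact hx
  obtain ⟨P', hle, hP', h1⟩ := TensorProduct.eq_zero_of_fg_of_subtype_eq_zero (hJ.map f) h0
  obtain ⟨T, hT, hIT, hinj⟩ := h (P'.map P.subtype) (hP'.map _) (P.map_subtype_le P')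
  apply hinj
  have h2 := congrArg ((Submodule.inclusion hT ∘ₗ P.subtype.submoduleMap P').rTensor N) h1
  rw [map_zero, ← LinearMap.rTensor_comp_apply, ← LinearMap.rTensor_comp_apply] at h2
  rw [map_zero, ← LinearMap.rTensor_comp_apply]
  exact h2

/-- The maximal ideal is the directed union of the annihilators of `w * v ≠ 0`, and multiplication
by `w` identifies `ann(w * v) / ann(w)` with `ann(v)`. The induction hypothesis for `v`, with
flatness of the maximal ideal, makes `ann(v) ⊗ K → ann(v) ⊗ F` injective. -/
theorem IsTotalChainRing.rTensor_inclusion_torsionOf_injective {R : Type u} [CommRing R]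
    [IsLocalRing R] (hR : IsTotalChainRing R) (hm : Module.Flat R (maximalIdeal R)) {M : Type u}
    [AddCommGroup M] [Module R M] (h : HasFiniteFlatDim R M) (w : R)
    (hw : Ideal.torsionOf R R w ≤ maximalIdeal R) :
    Function.Injective ((Submodule.inclusion hw).rTensor M) := by
  induction h generalizing w with
  | of_flat M hM =>
    exact Module.Flat.rTensor_preserves_injective_linearMap _ (Submodule.inclusion_injective hw)
  | of_exact K F M ι π hι hex hπ hF hK ih =>
    have hK' : ∀ (v : R) (_ : v ≠ 0), Function.Injective (ι.lTensor (Ideal.torsionOf R R v)) := by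
      intro v hv
      have hvm := le_maximalIdeal ((Ideal.torsionOf_eq_top_iff R v).not.mpr hv)
      have h1 : Function.Injective (ι.lTensor (maximalIdeal R)) :=
        Module.Flat.lTensor_preserves_injective_linearMap ι hι
      have h2 := h1.comp (ih v hvm)
      rw [← LinearMap.coe_comp, LinearMap.lTensor_comp_rTensor,
        ← LinearMap.rTensor_comp_lTensor, LinearMap.coe_comp] at h2
      exact h2.of_comp
    have hw0 : w ≠ 0 := fun h0 => (maximalIdeal.isMaximal R).ne_top
      (top_le_iff.mp ((Ideal.torsionOf_eq_top_iff R w).mpr h0 ▸ hw))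
    refine rTensor_inclusion_injective_of_directed hw M fun Q hQ hQm => ?_
    have : ∃ z, ¬ IsUnit z ∧ ∀ q ∈ Q, z ∣ q := by
      have := IsBezout.of_dvd_total hR.dvd_total
      obtain ⟨z, rfl⟩ := (IsBezout.isPrincipal_of_FG Q hQ).principal
      exact ⟨z, hQm (Submodule.mem_span_singleton_self z), fun q hq =>
        Ideal.mem_span_singleton.mp hq⟩
    obtain ⟨z, hz, hzQ⟩ := this
    obtain ⟨v, hv, hzv⟩ := hR.exists_mul_ne_zero hw0 hz
    have hle : Ideal.torsionOf R R w ≤ Ideal.torsionOf R R (w * v) := fun x hx => by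
      simp only [Ideal.mem_torsionOf_iff, smul_eq_mul] at hx ⊢
      linear_combination v * hx
    refine ⟨Ideal.torsionOf R R (w * v), fun q hq => ?_, hle, ?_⟩
    · obtain ⟨c, rfl⟩ := hzQ q hq
      simp only [Ideal.mem_torsionOf_iff, smul_eq_mul]
      linear_combination c * hzv
    have hv0 : v ≠ 0 := right_ne_zero_of_mul hv
    let p : Ideal.torsionOf R R (w * v) →ₗ[R] Ideal.torsionOf R R v :=
      ((LinearMap.mulLeft R w) ∘ₗ (Ideal.torsionOf R R (w * v)).subtype).codRestrict _ fun x => by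
        have := x.2
        simp only [Ideal.mem_torsionOf_iff, smul_eq_mul] at this
        simp only [LinearMap.comp_apply, Submodule.subtype_apply, LinearMap.mulLeft_apply,
          Ideal.mem_torsionOf_iff, smul_eq_mul]
        linear_combination this
    have hpx : ∀ x, (p x : R) = w * x := fun _ => rfl
    refine rTensor_injective_of_exact (Submodule.inclusion_injective hle) (p := p) ?_ ?_ hex hπ
      (hK' v hv0)
    · intro x
      constructor
      · intro hx
        have h1 : w * (x : R) = 0 := by rw [← hpx, hx]; rfl
        exact ⟨⟨x, by simpa [mul_comm] using h1⟩, rfl⟩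
      · rintro ⟨y, rfl⟩
        apply Subtype.ext
        rw [hpx]
        have := y.2
        simp only [Ideal.mem_torsionOf_iff, smul_eq_mul] at this
        rw [mul_comm]
        exact this
    · rintro ⟨x, hx⟩
      have hx' : x * v = 0 := hx
      rcases hR.dvd_total w x with ⟨y, rfl⟩ | ⟨y, rfl⟩
      · exact ⟨⟨y, by
          simp only [Ideal.mem_torsionOf_iff, smul_eq_mul]
          linear_combination hx'⟩, rfl⟩
      · exact absurd (by linear_combination y * hx') hv

theorem IsTotalChainRing.flat_torsionOf {R : Type u} [CommRing R]
    [IsLocalRing R] (hR : IsTotalChainRing R) (h : AllHaveFiniteFlatDim R) {w : R} (hw0 : w ≠ 0) :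
    Module.Flat R (Ideal.torsionOf R R w) := by
  have hm := hR.flat_maximalIdeal h
  have hw := le_maximalIdeal ((Ideal.torsionOf_eq_top_iff R w).not.mpr hw0)
  rw [Module.Flat.iff_lTensor_injective']
  intro I
  have h1 : Function.Injective (I.subtype.lTensor (maximalIdeal R)) :=
    Module.Flat.lTensor_preserves_injective_linearMap _ I.subtype_injective
  -- This injection `ann(w) ⊗ I → 𝔪 ⊗ R`, with `𝔪` the maximal ideal, factors through `ann(w) ⊗ R`.
  have h2 := h1.comp (hR.rTensor_inclusion_torsionOf_injective hm (h I) w hw)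
  rw [← LinearMap.coe_comp, LinearMap.lTensor_comp_rTensor,
    ← LinearMap.rTensor_comp_lTensor, LinearMap.coe_comp] at h2
  exact h2.of_comp

theorem IsTotalChainRing.isUnit_of_ne_zero {R : Type u} [CommRing R]
    [IsLocalRing R] (hR : IsTotalChainRing R) (h : AllHaveFiniteFlatDim R) {c : R} (hc : c ≠ 0) :
    IsUnit c := by
  by_contra hcu
  let T := Ideal.torsionOf R R
  have hT : ∀ {w x}, x ∈ T w ↔ x * w = 0 := Iff.rfl
  have hidem : ∀ w, w ≠ 0 → T w = T w * T w := by
    intro w hw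
    refine le_antisymm (fun x hx => ?_) Ideal.mul_le_left
    have := hR.flat_torsionOf h hw
    have h1 : (⟨x, hx⟩ : T w) ∈ T w • (⊤ : Submodule R (T w)) :=
      Module.Flat.mem_torsionOf_smul_top (Subtype.ext (by
        simpa [mul_comm] using hT.mp hx))
    have h2 := Submodule.mem_map_of_mem (f := (T w).subtype) h1
    rwa [Submodule.map_smul'', Submodule.map_subtype_top] at h2
  have hdiv : ∀ {w v}, w * v ≠ 0 → ∀ x ∈ T v, ∃ y ∈ T (w * v), x = w * y := by
    intro w v hwv x hx
    rcases hR.dvd_total w x with ⟨y, rfl⟩ | ⟨y, rfl⟩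
    · exact ⟨y, by rw [hT] at hx ⊢; linear_combination hx, rfl⟩
    · exact absurd (by linear_combination y * hT.mp hx) hwv
  have hann : ∀ {w}, w ≠ 0 → ¬ IsUnit w → ∃ x ∈ T w, x ≠ 0 := fun _ hu =>
    let ⟨n, hn, h0⟩ := hR.exists_mul_eq_zero _ hu
    ⟨n, by rw [hT]; linear_combination h0, hn⟩
  -- Here `T v = (T v)² = w² (T (w * v))² = 0`, whereas nonunits have nonzero annihilators.
  have hzero : ∀ w v, w * v ≠ 0 → (∀ y ∈ T (w * v), w * w * y = 0) → IsUnit v := by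
    intro w v hwv hy
    by_contra hu
    obtain ⟨x, hx, hx0⟩ := hann (right_ne_zero_of_mul hwv) hu
    rw [hidem v (right_ne_zero_of_mul hwv)] at hx
    refine hx0 ?_
    refine Submodule.mul_induction_on hx ?_ fun a b ha hb => by rw [ha, hb, add_zero]
    intro a ha b hb
    obtain ⟨a', ha', rfl⟩ := hdiv hwv a ha
    obtain ⟨b', hb', rfl⟩ := hdiv hwv b hb
    linear_combination b' * hy a' ha'
  have hsq : ∀ d : R, ¬ IsUnit d → d * d = 0 := by
    intro d hd
    by_contra hne
    exact hd (hzero d d hne fun y hy => by rw [hT] at hy; linear_combination hy)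
  have hmul : ∀ d e : R, ¬ IsUnit d → ¬ IsUnit e → d * e = 0 := by
    intro d e hd he
    by_contra hne
    exact he (hzero d e hne fun y _ => by rw [hsq d hd, zero_mul])
  have hc' : c ∈ T c := hmul c c hcu hcu
  rw [hidem c hc] at hc'
  have hTu : ∀ x ∈ T c, ¬ IsUnit x := fun x hx hu => hc (hu.mul_right_eq_zero.mp (hT.mp hx))
  exact hc (Submodule.mul_induction_on (C := fun x => x = 0) hc'
    (fun a ha b hb => hmul a b (hTu a ha) (hTu b hb)) fun a b ha hb => by rw [ha, hb, add_zero])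

/-! ### Valuation domains and the conclusion -/

theorem dvd_total_of_isLocalization {R : Type*} [CommRing R] (hR : ∀ a b : R, a ∣ b ∨ b ∣ a)
    (S : Submonoid R) (A : Type*) [CommRing A] [Algebra R A] [IsLocalization S A] (a b : A) :
    a ∣ b ∨ b ∣ a := by
  obtain ⟨x, y, s, hx, hy⟩ := IsLocalization.surj₂ S A a b
  have hs : IsUnit (algebraMap R A s) := IsLocalization.map_units A s
  have key : ∀ {x y : R} {a b : A}, a * algebraMap R A s = algebraMap R A x →
      b * algebraMap R A s = algebraMap R A y → x ∣ y → a ∣ b := by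
    intro x y a b hx hy h
    have := map_dvd (algebraMap R A) h
    rwa [← hx, ← hy, hs.mul_right_dvd, hs.dvd_mul_right] at this
  exact (hR x y).imp (key hx hy) (key hy hx)

theorem isLocalRing_of_dvd_total {R : Type*} [CommRing R] [Nontrivial R]
    (hR : ∀ a b : R, a ∣ b ∨ b ∣ a) : IsLocalRing R :=
  .of_isUnit_or_isUnit_one_sub_self fun a => (hR a (1 - a)).imp
    (fun h => isUnit_of_dvd_one (by simpa using dvd_add h (dvd_refl a)))
    (fun h => isUnit_of_dvd_one (by simpa using dvd_add (dvd_refl (1 - a)) h))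

/-- The total quotient ring is a total chain ring, hence a field, and it contains `R`. -/
theorem AllHaveFiniteFlatDim.noZeroDivisors {R : Type u} [CommRing R] [Nontrivial R]
    (h : AllHaveFiniteFlatDim R) (hR : ∀ a b : R, a ∣ b ∨ b ∣ a) : NoZeroDivisors R := by
  let A := Localization (nonZeroDivisors R)
  have hinj : Function.Injective (algebraMap R A) := IsLocalization.injective A le_rfl
  have : Nontrivial A := hinj.nontrivial
  have hA := dvd_total_of_isLocalization hR (nonZeroDivisors R) A
  have := isLocalRing_of_dvd_total hA
  have hT : IsTotalChainRing A := by
    refine ⟨hA, fun t ht => ?_⟩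
    obtain ⟨⟨x, s⟩, hx⟩ := IsLocalization.surj (nonZeroDivisors R) t
    have hs : IsUnit (algebraMap R A s) := IsLocalization.map_units A s
    have hxn : x ∉ nonZeroDivisors R := fun hxn => ht <| by
      have := IsLocalization.map_units A (⟨x, hxn⟩ : nonZeroDivisors R)
      change t * _ = algebraMap R A x at hx
      rw [← hx] at this
      exact isUnit_of_mul_isUnit_left this
    rw [mem_nonZeroDivisors_iff_right] at hxn
    push Not at hxn
    obtain ⟨n, hn, hn0⟩ := hxn
    refine ⟨algebraMap R A n, (map_ne_zero_iff _ hinj).mpr hn0, hs.mul_right_cancel ?_⟩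
    have := congrArg (algebraMap R A) hn
    rw [map_mul, map_zero] at this
    linear_combination this + algebraMap R A n * hx
  refine ⟨fun {a b} hab => or_iff_not_imp_left.mpr fun ha => ?_⟩
  have hu := hT.isUnit_of_ne_zero (h.localization (nonZeroDivisors R) A)
    ((map_ne_zero_iff _ hinj).mpr ha)
  exact hinj (by rw [map_zero, ← hu.mul_right_eq_zero, ← map_mul, hab, map_zero])

theorem flat_submodule_of_dvd_total {R F : Type*} [CommRing R] [NoZeroDivisors R]
    [AddCommGroup F] [Module R F] [Module.Flat R F] (hR : ∀ a b : R, a ∣ b ∨ b ∣ a) {K : Type*}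
    [AddCommGroup K] [Module R K] (i : K →ₗ[R] F) (hi : Function.Injective i) :
    Module.Flat R K := by
  refine .of_dvd_total hR fun r m hrm => ?_
  by_cases hr : r = 0
  · exact ⟨1, m, by simp [hr], (one_smul R m).symm⟩
  refine ⟨0, 0, zero_mul r, hi ?_⟩
  have h1 := Module.Flat.mem_torsionOf_smul_top (R := R) (r := r) (m := i m)
    (by rw [← map_smul, hrm, map_zero])
  have h2 : Ideal.torsionOf R R r = ⊥ :=
    (Submodule.eq_bot_iff _).mpr fun x hx => (mul_eq_zero.mp hx).resolve_right hr
  rw [h2, Submodule.bot_smul] at h1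
  simpa using h1

theorem IsFqpRing.flat_submodule {R : Type u} [CommRing R] (hR : IsFqpRing R)
    (h : AllHaveFiniteFlatDim R) (F : Type u) [AddCommGroup F] [Module R F] [Module.Flat R F]
    (K : Submodule R F) : Module.Flat R K := by
  refine Module.flat_of_localized_maximal _ fun P _ => ?_
  let S := P.primeCompl
  let A := Localization S
  have hloc : IsLocalRing A := Localization.AtPrime.isLocalRing P
  have hA := h.localization S A
  have hdvd := hA.dvd_total (hR.hasPairDualBases.localization S A)
  have := hA.noZeroDivisors hdvd
  let gK := LocalizedModule.mkLinearMap S K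
  let gF := LocalizedModule.mkLinearMap S F
  have : Module.Flat A (LocalizedModule S F) := Module.Flat.of_isLocalizedModule A S gF
  have hK : Module.Flat A (LocalizedModule S K) := flat_submodule_of_dvd_total hdvd
    ((IsLocalizedModule.map S gK gF K.subtype).extendScalarsOfIsLocalization S A)
    (IsLocalizedModule.map_injective S gK gF _ K.subtype_injective)
  exact (Module.flat_iff_of_isLocalization A S (LocalizedModule S K)).mp hK

theorem theoremF13 (R : Type u) [CommRing R] (hR : IsFqpRing R) :
    weakGlobalDim R = 0 ∨ weakGlobalDim R = 1 ∨ weakGlobalDim R = ⊤ := by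
  by_cases htop : weakGlobalDim R = ⊤
  · exact .inr (.inr htop)
  have hle : weakGlobalDim R ≤ 1 := weakGlobalDim_le_one
    (hR.flat_submodule (allHaveFiniteFlatDim_of_weakGlobalDim_ne_top htop))
  rcases hle.lt_or_eq with h | h
  · exact .inl (Order.lt_one_iff.mp h)
  · exact .inr (.inl h)
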